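/- **Formulas and logics.** Formulas are built from $\bot$ and countably many propositional variables by $\wedge,\vee,\to,\circ,\Diamond,\forall$ (with $\neg\varphi=\varphi\to\bot$, $\top=\neg\bot$, and $\varphi\leftrightarrow\psi$ short for $(\varphi\to\psi)\wedge(\psi\to\varphi)$). For $M\subseteq\{\Diamond,\forall\}$, $\mathcal L_M$ is the set of formulas whose modalities other than $\circ$ belong to $M$. An *admissible logic* over $\mathcal L_M$ is (given by its set of theorems) a set $\Lambda\subseteq\mathcal L_M$ that contains all instances in $\mathcal L_M$ of the axioms of intuitionistic propositional logic and of $\neg\circ\bot$, $\circ\varphi\wedge\circ\psi\to\circ(\varphi\wedge\psi)$, $\circ(\varphi\vee\psi)\to\circ\varphi\vee\circ\psi$, $\circ(\varphi\to\psi)\to(\circ\varphi\to\circ\psi)$, $\varphi\vee\circ\Diamond\varphi\to\Diamond\varphi$, $\forall\varphi\vee\neg\forall\varphi$, $\forall(\varphi\to\psi)\to(\forall\varphi\to\forall\psi)$, $\forall(\varphi\vee\forall\psi)\to\forall\varphi\vee\forall\psi$, $\forall\varphi\to\varphi$, $\forall\varphi\to\forall\forall\varphi$, $\forall\varphi\leftrightarrow\circ\forall\varphi$,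 and is closed under modus ponens and $\varphi/\circ\varphi$; if $\Diamond\in M$, under $(\varphi\to\psi)/(\Diamond\varphi\to\Diamond\psi)$ and $(\circ\varphi\to\varphi)/(\Diamond\varphi\to\varphi)$; and if $\forall\in M$, under $\varphi/\forall\varphi$. Write $\vdash\varphi$ for $\varphi\in\Lambda$. **Types.** Let $\Delta$ be a set of formulas closed under subformulas. A *$\Delta$-type* is a pair $\Phi=(\Phi^+;\Phi^-)$ of disjoint subsets of $\Delta$ such that: $\bot\notin\Phi^+$; $\varphi\wedge\psi\in\Phi^+$ implies $\varphi,\psi\in\Phi^+$; $\varphi\wedge\psi\in\Phi^-$ implies $\varphi\in\Phi^-$ or $\psi\in\Phi^-$; $\varphi\vee\psi\in\Phi^+$ implies $\varphi\in\Phi^+$ or $\psi\in\Phi^+$; $\varphi\vee\psi\in\Phi^-$ implies $\varphi,\psi\in\Phi^-$; $\varphi\to\psi\in\Phi^+$ implies $\varphi\in\Phi^-$ or $\psi\in\Phi^+$; $\varphi\to\psi\in\Phi^-$ implies $\psi\in\Phi^-$; $\Diamond\varphi\in\Phi^-$ implies $\varphi\in\Phi^-$. It is *saturated* if $\Phi^+\cup\Phi^-=\Delta$.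 A pair $(\Phi,\Psi)$ is *sensible* if for all $\varphi$: $\circ\varphi\in\Phi^\pm$ implies $\varphi\in\Psi^\pm$ (for each sign); $\Diamond\varphi\in\Phi^+$ implies $\varphi\in\Phi^+$ or $\Diamond\varphi\in\Psi^+$; $\Diamond\varphi\in\Phi^-$ implies $\Diamond\varphi\in\Psi^-$; $\forall\varphi\in\Phi^\pm$ iff $\forall\varphi\in\Psi^\pm$ (for each sign). **Quasimodels.** A *weak $\Delta$-quasimodel* is a poset $(W,\preccurlyeq)$ with a labelling $\ell$ of its points by $\Delta$-types and a relation $S\subseteq W\times W$ such that: $w\preccurlyeq v$ implies $\ell^+(w)\subseteq\ell^+(v)$ and $\ell^-(v)\subseteq\ell^-(w)$; if $\varphi\to\psi\in\ell^-(w)$ and $\varphi\notin\ell^+(w)$, there is $v\succcurlyeq w$ with $\varphi\in\ell^+(v)$ and $\psi\in\ell^-(v)$; $S$ is forward confluent ($w'\succcurlyeq w\mathrel S v$ implies $w'\mathrel S v'\succcurlyeq v$ for some $v'$); and $(\ell(w),\ell(v))$ is sensible whenever $w\mathrel S v$. It is *saturated* if all labels are, and *deterministic* if $S$ is a function. $S$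 is *$\omega$-sensible* if it is serial and, whenever $\Diamond\varphi\in\ell^+(w)$, there are $n\ge 0$ and $v$ with $w\mathrel{S^n}v$ and $\varphi\in\ell^+(v)$. The labelling is *honest* if $\forall\varphi\in\ell^+(w)$ implies $\varphi\in\ell^+(v)$ for all $v$, and $\forall\varphi\in\ell^-(w)$ implies $\varphi\in\ell^-(v)$ for some $v$. A *$\Delta$-quasimodel* is an honest weak $\Delta$-quasimodel whose $S$ is $\omega$-sensible. **Simulations.** A *simulation* $E$ from $X$ to $Y$ is a forward confluent relation ($x'\succcurlyeq x\mathrel E y$ implies $x'\mathrel E y'\succcurlyeq y$ for some $y'$) such that $x\mathrel E y$ implies $\ell^\pm(x)\subseteq\ell^\pm(y)$; it is *dynamic* if $x\mathrel E y\mathrel S y'$ implies $x\mathrel S x'\mathrel E y'$ for some $x'$. Write $x\rightharpoonup y$ if some simulation relates $x$ to $y$. **Initial structures.** Let $\Sigma$ be finite and closed under subformulas. An *initial weak quasimodel* over $\Sigma$ is a saturated weak $\Sigma$-quasimodel $\mathfrak I$ such that, for every subformula-closed $\Delta\supseteq\Sigma$ and every saturated deterministic weak $\Delta$-quasimodel $\mathfrak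 A$, the relation $\rightharpoonup$ between $\mathfrak I$ and $\mathfrak A$ is a surjective dynamic simulation. The *moment structure* $\mathfrak I_\Sigma$ has as points the *$\Sigma$-moments*: finite (ordered) trees labelled by saturated $\Sigma$-types in which, along each edge from a node to a child, $\ell^+$ grows, $\ell^-$ shrinks and the label changes, the subtrees at distinct children of a node are distinct, and whenever $\varphi\to\psi\in\ell^-(a)$ and $\varphi\notin\ell^+(a)$ for a node $a$, some node $b$ above $a$ has $\varphi\in\ell^+(b)$ and $\psi\in\ell^-(b)$. Here $w\preccurlyeq v$ iff $v$ is the subtree of $w$ generated by a node, $\ell(w)$ is the label of the root, and $w\mathrel S v$ iff some forward confluent relation between moments, all of whose pairs have sensible labels, relates $w$ to $v$. For a finite initial weak quasimodel $\mathfrak I$ and $w\in\mathfrak I$, define by backwards induction on $\preccurlyeq$ $$\mathrm{Sim}(w)=\bigwedge\ell^+(w)\to\Big(\bigvee\ell^-(w)\vee\bigvee_{v\succ w}\mathrm{Sim}(v)\Big),$$ with $\bigwedge\varnothing=\top$ and $\bigvee\varnothing=\bot$. The *initial structure* $\mathfrak J_\Sigma$ (depending on $\Lambda$ and $\mathfrak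 I$) is the restriction of $\mathfrak I$ to the points $w$ with $\nvdash\mathrm{Sim}(w)$. **Statement.** Let $M\subseteq\{\Diamond,\forall\}$, let $\Lambda$ be an admissible logic over $\mathcal L_M$, and let $\Sigma\subseteq\mathcal L_M$ be finite and closed under subformulas. Then $\mathfrak I_\Sigma$ is finite and is an initial weak quasimodel over $\Sigma$. Moreover, for $\mathfrak I=\mathfrak I_\Sigma$, and for any other finite initial weak quasimodel $\mathfrak I$ over $\Sigma$, the initial structure $\mathfrak J_\Sigma$ is a weak $\Sigma$-quasimodel whose relation $S$ is serial and $\omega$-sensible; in particular, if no formula of the form $\forall\varphi$ belongs to $\Sigma$, then $\mathfrak J_\Sigma$ is a $\Sigma$-quasimodel. -/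

import Mathlib

universe u v

namespace ITL

/-! ### Formulas and temporal languages -/

/-- Formulas of the full `□`-free language, over the countably infinite set `ℕ` of propositional
variables: `next` is `○`, `dia` is `◇` (eventually), `all` is `∀` (everywhere). -/
inductive Formula : Type
  | bot : Formula
  | var : ℕ → Formula
  | conj : Formula → Formula → Formula
  | disj : Formula → Formula → Formula
  | imp : Formula → Formula → Formula
  | next : Formula → Formula
  | dia : Formula → Formula
  | all : Formula → Formula

namespace Formula

/-- `¬ φ` is `φ → ⊥`. -/
def neg (φ : Formula) : Formula := imp φ bot

/-- `⊤` is `⊥ → ⊥`. -/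
def top : Formula := imp bot bot

/-- `φ ↔ ψ` is `(φ → ψ) ∧ (ψ → φ)`. -/
def iff (φ ψ : Formula) : Formula := conj (imp φ ψ) (imp ψ φ)

/-- The set of subformulas of a formula (itself included). -/
def sub : Formula → Set Formula
  | bot => {bot}
  | var p => {var p}
  | conj φ ψ => {conj φ ψ} ∪ (sub φ ∪ sub ψ)
  | disj φ ψ => {disj φ ψ} ∪ (sub φ ∪ sub ψ)
  | imp φ ψ => {imp φ ψ} ∪ (sub φ ∪ sub ψ)
  | next φ => {next φ} ∪ sub φ
  | dia φ => {dia φ} ∪ sub φ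
  | all φ => {all φ} ∪ sub φ

/-- Conjunction of a finite list; the empty conjunction is `⊤`. -/
def bigAnd : List Formula → Formula
  | [] => top
  | φ :: l => conj φ (bigAnd l)

/-- Disjunction of a finite list; the empty disjunction is `⊥`. -/
def bigOr : List Formula → Formula
  | [] => bot
  | φ :: l => disj φ (bigOr l)

end Formula

open Formula

/-- The modalities that a temporal language may or may not contain (`○` is always present). -/
inductive Modality : Type
  | eventually : Modality
  | everywhere : Modality

/-- The temporal language `L_M`: the formulas whose modalities, other than `○`, are all in `M`. -/
def Lang (M : Set Modality) : Set Formula :=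
  {φ | (∀ ψ, dia ψ ∈ sub φ → Modality.eventually ∈ M) ∧
    (∀ ψ, all ψ ∈ sub φ → Modality.everywhere ∈ M)}

/-- `Δ` is closed under subformulas. -/
def SubClosed (Δ : Set Formula) : Prop := ∀ φ ∈ Δ, sub φ ⊆ Δ

/-! ### Logics -/

/-- All instances of the schemes defining the logics `ITL⁰_M`: intuitionistic propositional logic,
the schemes for `○`, the fixpoint scheme for `◇` and the schemes for `∀`. -/
inductive Scheme : Formula → Prop
  | k (φ ψ : Formula) : Scheme (imp φ (imp ψ φ))
  | s (φ ψ χ : Formula) :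
      Scheme (imp (imp φ (imp ψ χ)) (imp (imp φ ψ) (imp φ χ)))
  | andLeft (φ ψ : Formula) : Scheme (imp (conj φ ψ) φ)
  | andRight (φ ψ : Formula) : Scheme (imp (conj φ ψ) ψ)
  | andIntro (φ ψ : Formula) : Scheme (imp φ (imp ψ (conj φ ψ)))
  | orLeft (φ ψ : Formula) : Scheme (imp φ (disj φ ψ))
  | orRight (φ ψ : Formula) : Scheme (imp ψ (disj φ ψ))
  | orElim (φ ψ χ : Formula) :
      Scheme (imp (imp φ χ) (imp (imp ψ χ) (imp (disj φ ψ) χ)))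
  | exFalso (φ : Formula) : Scheme (imp bot φ)
  | nextBot : Scheme (neg (next bot))
  | nextAnd (φ ψ : Formula) : Scheme (imp (conj (next φ) (next ψ)) (next (conj φ ψ)))
  | nextOr (φ ψ : Formula) : Scheme (imp (next (disj φ ψ)) (disj (next φ) (next ψ)))
  | nextImp (φ ψ : Formula) : Scheme (imp (next (imp φ ψ)) (imp (next φ) (next ψ)))
  | diaFix (φ : Formula) : Scheme (imp (disj φ (next (dia φ))) (dia φ))
  | allEM (φ : Formula) : Scheme (disj (all φ) (neg (all φ)))
  | allImp (φ ψ : Formula) : Scheme (imp (all (imp φ ψ)) (imp (all φ) (all ψ)))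
  | allOr (φ ψ : Formula) : Scheme (imp (all (disj φ (all ψ))) (disj (all φ) (all ψ)))
  | allT (φ : Formula) : Scheme (imp (all φ) φ)
  | allFour (φ : Formula) : Scheme (imp (all φ) (all (all φ)))
  | allNext (φ : Formula) : Scheme (iff (all φ) (next (all φ)))

/-- An admissible intuitionistic temporal logic over `L_M`, given by its set `Λ` of theorems: a
subset of `L_M` that contains all instances in `L_M` of the schemes of `ITL⁰_M` and is closed
under the rules of `ITL⁰_M`. (An instance of a scheme for `◇` or `∀` lies in `L_M` only if that
modality is in `M`.) -/
structure IsAdmissible (M : Set Modality) (Λ : Set Formula) : Prop where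
  subset_lang : Λ ⊆ Lang M
  scheme : ∀ φ ∈ Lang M, Scheme φ → φ ∈ Λ
  mp : ∀ φ ψ, φ ∈ Λ → imp φ ψ ∈ Λ → ψ ∈ Λ
  nec_next : ∀ φ, φ ∈ Λ → next φ ∈ Λ
  dia_mono : Modality.eventually ∈ M → ∀ φ ψ, imp φ ψ ∈ Λ → imp (dia φ) (dia ψ) ∈ Λ
  dia_ind : Modality.eventually ∈ M → ∀ φ, imp (next φ) φ ∈ Λ → imp (dia φ) φ ∈ Λ
  nec_all : Modality.everywhere ∈ M → ∀ φ, φ ∈ Λ → all φ ∈ Λ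

/-! ### Two-sided types -/

/-- A pair `Φ = (Φ⁺ ; Φ⁻)` of sets of formulas. -/
@[ext]
structure TwoSided : Type where
  pos : Set Formula
  neg : Set Formula

namespace TwoSided

/-- `Φ` is a two-sided `Δ`-type. -/
structure IsType (Δ : Set Formula) (Φ : TwoSided) : Prop where
  pos_subset : Φ.pos ⊆ Δ
  neg_subset : Φ.neg ⊆ Δ
  inter : Φ.neg ∩ Φ.pos = ∅
  bot_pos : bot ∉ Φ.pos
  and_pos : ∀ φ ψ, conj φ ψ ∈ Φ.pos → φ ∈ Φ.pos ∧ ψ ∈ Φ.pos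
  and_neg : ∀ φ ψ, conj φ ψ ∈ Φ.neg → φ ∈ Φ.neg ∨ ψ ∈ Φ.neg
  or_pos : ∀ φ ψ, disj φ ψ ∈ Φ.pos → φ ∈ Φ.pos ∨ ψ ∈ Φ.pos
  or_neg : ∀ φ ψ, disj φ ψ ∈ Φ.neg → φ ∈ Φ.neg ∧ ψ ∈ Φ.neg
  imp_pos : ∀ φ ψ, imp φ ψ ∈ Φ.pos → φ ∈ Φ.neg ∨ ψ ∈ Φ.pos
  imp_neg : ∀ φ ψ, imp φ ψ ∈ Φ.neg → ψ ∈ Φ.neg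
  dia_neg : ∀ φ, dia φ ∈ Φ.neg → φ ∈ Φ.neg

/-- `Φ` is saturated (relative to `Δ`). -/
def Saturated (Δ : Set Formula) (Φ : TwoSided) : Prop := Δ = Φ.neg ∪ Φ.pos

/-- `Φ ≼_T Ψ`. -/
def Le (Φ Ψ : TwoSided) : Prop := Ψ.neg ⊆ Φ.neg ∧ Φ.pos ⊆ Ψ.pos

/-- `Φ ⊆_T Ψ`. -/
def Sub (Φ Ψ : TwoSided) : Prop := Φ.neg ⊆ Ψ.neg ∧ Φ.pos ⊆ Ψ.pos

/-- `φ → ψ` is a defect of `Φ`. -/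
def Defect (Φ : TwoSided) (φ ψ : Formula) : Prop := imp φ ψ ∈ Φ.neg ∧ φ ∉ Φ.pos

/-- A point with label `Φ` revokes the defect `φ → ψ`. -/
def Revokes (Φ : TwoSided) (φ ψ : Formula) : Prop := φ ∈ Φ.pos ∧ ψ ∈ Φ.neg

/-- The ordered pair `(Φ, Ψ)` is sensible. -/
structure Sensible (Φ Ψ : TwoSided) : Prop where
  next_pos : ∀ φ, next φ ∈ Φ.pos → φ ∈ Ψ.pos
  next_neg : ∀ φ, next φ ∈ Φ.neg → φ ∈ Ψ.neg
  dia_pos : ∀ φ, dia φ ∈ Φ.pos → φ ∈ Φ.pos ∨ dia φ ∈ Ψ.pos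
  dia_neg : ∀ φ, dia φ ∈ Φ.neg → dia φ ∈ Ψ.neg
  all_pos : ∀ φ, all φ ∈ Φ.pos ↔ all φ ∈ Ψ.pos
  all_neg : ∀ φ, all φ ∈ Φ.neg ↔ all φ ∈ Ψ.neg

end TwoSided

/-! ### Labelled systems and quasimodels -/

/-- The data of a labelled structure on a poset: a partial order, a successor relation and a
labelling by pairs of sets of formulas, with no compatibility between them required yet. -/
structure LabelledStructure : Type (u + 1) where
  World : Type u
  [order : PartialOrder World]
  succ : World → World → Prop
  label : World → TwoSided

attribute [instance] LabelledStructure.order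

/-- A continuous relation between posets with their up-set topologies, i.e. one for which
preimages of up-sets are up-sets: forward confluence. -/
def ForwardConfluent {α : Type u} {β : Type v} [PartialOrder α] [PartialOrder β]
    (R : α → β → Prop) : Prop :=
  ∀ x x' y, x ≤ x' → R x y → ∃ y', y ≤ y' ∧ R x' y'

namespace LabelledStructure

/-- `(W, ≼, ℓ)` is a `Δ`-labelled poset: labels are `Δ`-types, `ℓ` is monotone (continuous), and
every defect of `ℓ(w)` is revoked above `w`. -/
structure IsLabelledFrame (Δ : Set Formula) (W : LabelledStructure.{u}) : Prop where
  isType : ∀ w, (W.label w).IsType Δ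
  mono : ∀ w v, w ≤ v → (W.label w).Le (W.label v)
  revoke : ∀ w φ ψ, (W.label w).Defect φ ψ → ∃ v, w ≤ v ∧ (W.label v).Revokes φ ψ

/-- A weak `Δ`-quasimodel: a `Δ`-labelled poset whose successor relation is continuous and
sensible. -/
structure IsWeakQuasimodel (Δ : Set Formula) (W : LabelledStructure.{u}) : Prop where
  frame : W.IsLabelledFrame Δ
  continuous : ForwardConfluent W.succ
  sensible : ∀ w v, W.succ w v → (W.label w).Sensible (W.label v)

/-- The successor relation is serial. -/
def Serial (W : LabelledStructure.{u}) : Prop := ∀ w, ∃ v, W.succ w v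

/-- The successor relation is `ω`-sensible: it is serial, and every positive `◇ φ` is realized
after finitely many (possibly zero) steps. -/
def OmegaSensible (W : LabelledStructure.{u}) : Prop :=
  W.Serial ∧ ∀ w φ, dia φ ∈ (W.label w).pos →
    ∃ v, Relation.ReflTransGen W.succ w v ∧ φ ∈ (W.label v).pos

/-- The labelling is honest. -/
def Honest (W : LabelledStructure.{u}) : Prop :=
  ∀ w φ, (all φ ∈ (W.label w).pos → ∀ v, φ ∈ (W.label v).pos) ∧
    (all φ ∈ (W.label w).neg → ∃ v, φ ∈ (W.label v).neg)

/-- A `Δ`-quasimodel: a weak `Δ`-quasimodel that is honest and `ω`-sensible. -/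
structure IsQuasimodel (Δ : Set Formula) (W : LabelledStructure.{u}) : Prop where
  weak : W.IsWeakQuasimodel Δ
  honest : W.Honest
  omegaSensible : W.OmegaSensible

/-- All labels are saturated. -/
def IsSaturated (Δ : Set Formula) (W : LabelledStructure.{u}) : Prop :=
  ∀ w, (W.label w).Saturated Δ

/-- The successor relation is a function. -/
def Deterministic (W : LabelledStructure.{u}) : Prop := ∀ w, ∃! v, W.succ w v

/-- The restriction of a labelled structure to a set of worlds. -/
def restrict (W : LabelledStructure.{u}) (U : Set W.World) : LabelledStructure.{u} where
  World := U
  succ := fun w v => W.succ w.1 v.1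
  label := fun w => W.label w.1

/-! ### Simulations -/

/-- `E` is a simulation: a continuous relation with `ℓ(x) ⊆_T ℓ(y)` whenever `x E y`. -/
structure IsSimulation (X : LabelledStructure.{u}) (Y : LabelledStructure.{v})
    (E : X.World → Y.World → Prop) : Prop where
  continuous : ForwardConfluent E
  label : ∀ x y, E x y → (X.label x).Sub (Y.label y)

/-- `E` is dynamic: if `x E y S y'` then `x S x' E y'` for some `x'`. -/
def IsDynamic (X : LabelledStructure.{u}) (Y : LabelledStructure.{v})
    (E : X.World → Y.World → Prop) : Prop :=
  ∀ x y y', E x y → Y.succ y y' → ∃ x', X.succ x x' ∧ E x' y'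

/-- `(X, x) ⇀ (Y, y)`: some simulation relates `x` to `y`. -/
def Simulates (X : LabelledStructure.{u}) (Y : LabelledStructure.{v})
    (x : X.World) (y : Y.World) : Prop :=
  ∃ E : X.World → Y.World → Prop, IsSimulation X Y E ∧ E x y

/-- The defining properties of the initial weak quasimodel over `Sig` (together with finiteness):
a saturated weak quasimodel for which `⇀` is a surjective dynamic simulation onto every saturated
deterministic weak `Δ`-quasimodel with `Sig ⊆ Δ`. -/
structure IsInitial (Sig : Finset Formula) (I : LabelledStructure.{u}) : Prop where
  weak : I.IsWeakQuasimodel (Sig : Set Formula)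
  saturated : I.IsSaturated (Sig : Set Formula)
  universal : ∀ (Δ : Set Formula) (A : LabelledStructure.{v}),
    (Sig : Set Formula) ⊆ Δ → SubClosed Δ →
    A.IsWeakQuasimodel Δ → A.IsSaturated Δ → A.Deterministic →
    IsSimulation I A (Simulates I A) ∧ IsDynamic I A (Simulates I A) ∧
      ∀ a, ∃ w, Simulates I A w a

/-! ### Simulation formulas and the initial structure -/

open Classical in
/-- The simulation formula of a world of a finite `Sig`-labelled poset, by backwards induction:
`Sim(w) = ⋀ ℓ⁺(w) → ⋁ ℓ⁻(w) ∨ ⋁_{v ≻ w} Sim(v)`. -/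
noncomputable def Sim (Sig : Finset Formula) (W : LabelledStructure.{u}) [Finite W.World]
    (w : W.World) : Formula :=
  imp (bigAnd (Sig.filter (fun φ => φ ∈ (W.label w).pos)).toList)
    (disj (bigOr (Sig.filter (fun φ => φ ∈ (W.label w).neg)).toList)
      (bigOr ((Set.toFinite {v : W.World | w < v}).toFinset.attach.toList.map
        (fun v => Sim Sig W v.1))))
termination_by (wellFounded_gt (α := W.World)).wrap w
decreasing_by
  have h := v.2
  simp only [Set.Finite.mem_toFinset, Set.mem_ofPred_eq] at h
  exact h

/-- The possible worlds: those whose simulation formula is not a theorem of `Λ`. -/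
def possible (Λ : Set Formula) (Sig : Finset Formula) (W : LabelledStructure.{u})
    [Finite W.World] : Set W.World :=
  {w | Sim Sig W w ∉ Λ}

/-- The structure `J_Σ`: the restriction of the initial weak quasimodel to its possible worlds. -/
noncomputable def initialStructure (Λ : Set Formula) (Sig : Finset Formula)
    (I : LabelledStructure.{u}) [Finite I.World] : LabelledStructure.{u} :=
  I.restrict (possible Λ Sig I)

end LabelledStructure

/-! ### The structure of moments -/

/-- Finite trees labelled by pairs of sets of formulas: a root label and a finite sequence of
immediate subtrees. -/
inductive LTree : Type
  | node (Φ : TwoSided) (n : ℕ) (child : Fin n → LTree) : LTree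

namespace LTree

/-- The label of the root. -/
def root : LTree → TwoSided
  | node Φ _ _ => Φ

/-- `Subtree t s`: `s` is the subtree of `t` generated by some node of `t`. -/
inductive Subtree : LTree → LTree → Prop
  | refl (t : LTree) : Subtree t t
  | step (Φ : TwoSided) (n : ℕ) (child : Fin n → LTree) (i : Fin n) (s : LTree) :
      Subtree (child i) s → Subtree (node Φ n child) s

/-- The number of nodes. -/
def size : LTree → ℕ
  | node _ _ child => 1 + ∑ i, size (child i)

theorem Subtree.trans {t s r : LTree} (h : Subtree t s) (h' : Subtree s r) : Subtree t r := by
  induction h with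
  | refl t => exact h'
  | step Φ n child i s _ ih => exact Subtree.step Φ n child i r (ih h')

theorem Subtree.eq_or_size_lt {t s : LTree} (h : Subtree t s) : t = s ∨ size s < size t := by
  induction h with
  | refl t => exact Or.inl rfl
  | step Φ n child i s _ ih =>
    right
    have h1 : size (child i) ≤ ∑ j, size (child j) :=
      Finset.single_le_sum (f := fun j => size (child j)) (fun _ _ => Nat.zero_le _)
        (Finset.mem_univ i)
    have h2 : size (node Φ n child) = 1 + ∑ j, size (child j) := rfl
    rcases ih with rfl | ih <;> omega

theorem Subtree.antisymm {t s : LTree} (h : Subtree t s) (h' : Subtree s t) : t = s := by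
  rcases h.eq_or_size_lt with h1 | h1
  · exact h1
  · rcases h'.eq_or_size_lt with h2 | h2
    · exact h2.symm
    · omega

/-- `t` is a `Sig`-moment: a finite labelled tree in which every label is a saturated `Sig`-type,
labels strictly increase along edges, immediate subtrees of a node are pairwise distinct, and
every defect of a node is revoked above it. -/
def IsMoment (Sig : Finset Formula) : LTree → Prop
  | node Φ _ child =>
      Φ.IsType (Sig : Set Formula) ∧ Φ.Saturated (Sig : Set Formula) ∧
      Function.Injective child ∧
      (∀ i, Φ.Le (root (child i)) ∧ Φ ≠ root (child i)) ∧
      (∀ φ ψ, Φ.Defect φ ψ → ∃ i s, Subtree (child i) s ∧ (root s).Revokes φ ψ) ∧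
      ∀ i, IsMoment Sig (child i)

end LTree

/-- The type of `Sig`-moments. -/
def Moment (Sig : Finset Formula) : Type := {t : LTree // LTree.IsMoment Sig t}

/-- Moments are ordered by `w ≼ v` if and only if `v` is a subtree of `w`. -/
instance Moment.partialOrder (Sig : Finset Formula) : PartialOrder (Moment Sig) where
  le w v := LTree.Subtree w.1 v.1
  le_refl w := LTree.Subtree.refl w.1
  le_trans _ _ _ h h' := h.trans h'
  le_antisymm _ _ h h' := Subtype.ext (h.antisymm h')

/-- The initial weak quasimodel `I_Σ` of moments: a moment is labelled by its root, and `v` is a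
successor of `w` if some continuous and sensible relation relates the root of `w` to that of `v`
(a node of a moment being identified with the subtree it generates). -/
def momentStructure (Sig : Finset Formula) : LabelledStructure.{0} where
  World := Moment Sig
  succ := fun w v => ∃ R : Moment Sig → Moment Sig → Prop, ForwardConfluent R ∧
    (∀ x y, R x y → (LTree.root x.1).Sensible (LTree.root y.1)) ∧ R w v
  label := fun w => LTree.root w.1

end ITL

namespace ITL

open Formula

/-! ### Temporal languages -/

section Language

variable {M : Set Modality} {φ ψ : Formula}

/-! The bridge between syntax and semantics is the canonical structure of prime theories over `Λ`,
ordered by inclusion, with successor `T ↦ {φ | next φ ∈ T}`. It is a saturated deterministic weak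
quasimodel over the whole language, so initiality makes `⇀` from `I` to it dynamic. It need not be
ω-sensible; that property is recovered on the finite side.

Simulation formulas internalize `⇀`: `Sim w` fails at a prime theory `T` exactly when `w` simulates
some prime theory extending `T` (`sim_notMem_iff`). Hence the possible worlds are those that
simulate some point of the canonical structure (`mem_possible_iff`). They form an up-set, and
dynamicity yields seriality.

For ω-sensibility, suppose that `dia φ` is positive at `w` but `φ` holds at no reachable point. Let
`χ` be the conjunction of `Sim v` over the finitely many reachable `v`. Dynamicity gives `○χ → χ`,
and negativity of `φ` at each `v` gives `φ → χ`. The induction rule yields `◇φ → χ`, so `Sim w`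
holds at every prime theory containing `dia φ`. But `w` simulates such a theory, where `Sim w`
fails.

Moments are finite in number because the corank, the number of formulas of `Sig` not yet positive,
drops along every edge. For initiality, each point of a saturated weak quasimodel is unravelled into
a moment that keeps only steps lowering the corank (`momentTree`). This moment simulates the point,
and lifting it along successors gives dynamicity. -/

theorem Formula.self_mem_sub (φ : Formula) : φ ∈ sub φ := by
  cases φ <;> simp [sub]

theorem bot_mem_lang : bot ∈ Lang M := by simp [Lang, sub]

theorem conj_mem_lang : conj φ ψ ∈ Lang M ↔ φ ∈ Lang M ∧ ψ ∈ Lang M := by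
  simp only [Lang, sub, Set.mem_ofPred_eq, Set.mem_union, Set.mem_singleton_iff, reduceCtorEq,
    false_or]
  grind

theorem disj_mem_lang : disj φ ψ ∈ Lang M ↔ φ ∈ Lang M ∧ ψ ∈ Lang M := by
  simp only [Lang, sub, Set.mem_ofPred_eq, Set.mem_union, Set.mem_singleton_iff, reduceCtorEq,
    false_or]
  grind

theorem imp_mem_lang : imp φ ψ ∈ Lang M ↔ φ ∈ Lang M ∧ ψ ∈ Lang M := by
  simp only [Lang, sub, Set.mem_ofPred_eq, Set.mem_union, Set.mem_singleton_iff, reduceCtorEq,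
    false_or]
  grind

theorem next_mem_lang : next φ ∈ Lang M ↔ φ ∈ Lang M := by
  simp only [Lang, sub, Set.mem_ofPred_eq, Set.mem_union, Set.mem_singleton_iff, reduceCtorEq,
    false_or]

theorem dia_mem_lang : dia φ ∈ Lang M ↔ Modality.eventually ∈ M ∧ φ ∈ Lang M := by
  simp only [Lang, sub, Set.mem_ofPred_eq, Set.mem_union, Set.mem_singleton_iff, reduceCtorEq,
    false_or, dia.injEq]
  exact ⟨fun h => ⟨h.1 φ (.inl rfl), fun ψ hψ => h.1 ψ (.inr hψ), h.2⟩,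
    fun h => ⟨fun _ _ => h.1, h.2.2⟩⟩

theorem all_mem_lang : all φ ∈ Lang M ↔ Modality.everywhere ∈ M ∧ φ ∈ Lang M := by
  simp only [Lang, sub, Set.mem_ofPred_eq, Set.mem_union, Set.mem_singleton_iff, reduceCtorEq,
    false_or, all.injEq]
  exact ⟨fun h => ⟨h.2 φ (.inl rfl), h.1, fun ψ hψ => h.2 ψ (.inr hψ)⟩,
    fun h => ⟨h.2.1, fun _ _ => h.1⟩⟩

theorem bigAnd_mem_lang {l : List Formula} : bigAnd l ∈ Lang M ↔ ∀ φ ∈ l, φ ∈ Lang M := by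
  induction l with
  | nil => simp [bigAnd, top, imp_mem_lang, bot_mem_lang]
  | cons φ l ih => simp [bigAnd, conj_mem_lang, ih]

theorem bigOr_mem_lang {l : List Formula} : bigOr l ∈ Lang M ↔ ∀ φ ∈ l, φ ∈ Lang M := by
  induction l with
  | nil => simp [bigOr, bot_mem_lang]
  | cons φ l ih => simp [bigOr, disj_mem_lang, ih]

theorem subClosed_lang (M : Set Modality) : SubClosed (Lang M) := by
  intro φ
  induction φ with
  | bot => intro h; simpa [sub] using h
  | var p => intro h; simpa [sub] using h
  | conj φ ψ h₁ h₂ =>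
    intro h
    have h' := conj_mem_lang.1 h
    simp [sub, Set.insert_subset_iff, h, h₁ h'.1, h₂ h'.2]
  | disj φ ψ h₁ h₂ =>
    intro h
    have h' := disj_mem_lang.1 h
    simp [sub, Set.insert_subset_iff, h, h₁ h'.1, h₂ h'.2]
  | imp φ ψ h₁ h₂ =>
    intro h
    have h' := imp_mem_lang.1 h
    simp [sub, Set.insert_subset_iff, h, h₁ h'.1, h₂ h'.2]
  | next φ h₁ =>
    intro h
    simp [sub, Set.insert_subset_iff, h, h₁ (next_mem_lang.1 h)]
  | dia φ h₁ =>
    intro h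
    simp [sub, Set.insert_subset_iff, h, h₁ (dia_mem_lang.1 h).2]
  | all φ h₁ =>
    intro h
    simp [sub, Set.insert_subset_iff, h, h₁ (all_mem_lang.1 h).2]

end Language

/-! ### Theories and prime theories -/

/-- A theory over `Λ`: a set of formulas of `L_M` containing `Λ` and closed under modus ponens. -/
structure IsTheory (M : Set Modality) (Λ T : Set Formula) : Prop where
  subset_lang : T ⊆ Lang M
  le : Λ ⊆ T
  mp : ∀ φ ψ, φ ∈ T → imp φ ψ ∈ T → ψ ∈ T

/-- A prime theory: a consistent theory with the disjunction property. -/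
structure IsPrimeTheory (M : Set Modality) (Λ T : Set Formula) : Prop extends IsTheory M Λ T where
  bot_notMem : bot ∉ T
  prime : ∀ φ ψ, disj φ ψ ∈ T → φ ∈ T ∨ ψ ∈ T

section Theory

variable {M : Set Modality} {Λ T : Set Formula} {φ ψ χ : Formula}

theorem IsAdmissible.isTheory (hΛ : IsAdmissible M Λ) : IsTheory M Λ Λ :=
  ⟨hΛ.subset_lang, subset_rfl, hΛ.mp⟩

namespace IsTheory

theorem scheme_mem (hT : IsTheory M Λ T) (hΛ : IsAdmissible M Λ) (h : φ ∈ Lang M)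
    (hs : Scheme φ) : φ ∈ T :=
  hT.le (hΛ.scheme φ h hs)

theorem weaken (hT : IsTheory M Λ T) (hΛ : IsAdmissible M Λ) (hφ : φ ∈ T) (hψ : ψ ∈ Lang M) :
    imp ψ φ ∈ T :=
  hT.mp _ _ hφ (hT.scheme_mem hΛ (by simp [imp_mem_lang, hψ, hT.subset_lang hφ]) (.k φ ψ))

theorem distrib (hT : IsTheory M Λ T) (hΛ : IsAdmissible M Λ) (h : imp φ (imp ψ χ) ∈ T)
    (h' : imp φ ψ ∈ T) : imp φ χ ∈ T := by
  have hl := hT.subset_lang h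
  refine hT.mp _ _ h' (hT.mp _ _ h (hT.scheme_mem hΛ ?_ (.s φ ψ χ)))
  simp only [imp_mem_lang] at hl ⊢
  tauto

theorem imp_self (hT : IsTheory M Λ T) (hΛ : IsAdmissible M Λ) (hφ : φ ∈ Lang M) :
    imp φ φ ∈ T :=
  hT.distrib hΛ (ψ := imp φ φ)
    (hT.scheme_mem hΛ (by simp [imp_mem_lang, hφ]) (.k φ (imp φ φ)))
    (hT.scheme_mem hΛ (by simp [imp_mem_lang, hφ]) (.k φ φ))

theorem imp_trans (hT : IsTheory M Λ T) (hΛ : IsAdmissible M Λ) (h : imp φ ψ ∈ T)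
    (h' : imp ψ χ ∈ T) : imp φ χ ∈ T :=
  hT.distrib hΛ (hT.weaken hΛ h' (imp_mem_lang.1 (hT.subset_lang h)).1) h

theorem conj_mem (hT : IsTheory M Λ T) (hΛ : IsAdmissible M Λ) :
    conj φ ψ ∈ T ↔ φ ∈ T ∧ ψ ∈ T := by
  constructor
  · intro h
    have hl := conj_mem_lang.1 (hT.subset_lang h)
    exact ⟨hT.mp _ _ h (hT.scheme_mem hΛ (by simp [imp_mem_lang, conj_mem_lang, hl])
        (.andLeft φ ψ)),
      hT.mp _ _ h (hT.scheme_mem hΛ (by simp [imp_mem_lang, conj_mem_lang, hl]) (.andRight φ ψ))⟩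
  · rintro ⟨h, h'⟩
    exact hT.mp _ _ h' (hT.mp _ _ h (hT.scheme_mem hΛ
      (by simp [imp_mem_lang, conj_mem_lang, hT.subset_lang h, hT.subset_lang h']) (.andIntro φ ψ)))

theorem disj_mem_left (hT : IsTheory M Λ T) (hΛ : IsAdmissible M Λ) (h : φ ∈ T)
    (hψ : ψ ∈ Lang M) : disj φ ψ ∈ T :=
  hT.mp _ _ h (hT.scheme_mem hΛ (by simp [imp_mem_lang, disj_mem_lang, hψ, hT.subset_lang h])
    (.orLeft φ ψ))

theorem disj_mem_right (hT : IsTheory M Λ T) (hΛ : IsAdmissible M Λ) (h : ψ ∈ T)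
    (hφ : φ ∈ Lang M) : disj φ ψ ∈ T :=
  hT.mp _ _ h (hT.scheme_mem hΛ (by simp [imp_mem_lang, disj_mem_lang, hφ, hT.subset_lang h])
    (.orRight φ ψ))

theorem bigAnd_mem (hT : IsTheory M Λ T) (hΛ : IsAdmissible M Λ) {l : List Formula} :
    bigAnd l ∈ T ↔ ∀ φ ∈ l, φ ∈ T := by
  induction l with
  | nil => simpa [bigAnd, top] using hT.imp_self hΛ bot_mem_lang
  | cons φ l ih => simp [bigAnd, hT.conj_mem hΛ, ih]

/-- The theory generated by `T` and `φ`. -/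
theorem adjoin (hT : IsTheory M Λ T) (hΛ : IsAdmissible M Λ) (hφ : φ ∈ Lang M) :
    IsTheory M Λ {χ | imp φ χ ∈ T} where
  subset_lang _ h := (imp_mem_lang.1 (hT.subset_lang h)).2
  le _ h := hT.weaken hΛ (hT.le h) hφ
  mp _ _ h h' := hT.distrib hΛ h' h

/-- A theory omitting `ψ` extends to a prime theory omitting `ψ`. -/
theorem exists_prime (hT : IsTheory M Λ T) (hΛ : IsAdmissible M Λ) (hψ : ψ ∈ Lang M)
    (h : ψ ∉ T) : ∃ P, IsPrimeTheory M Λ P ∧ T ⊆ P ∧ ψ ∉ P := by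
  obtain ⟨P, hTP, hP⟩ := zorn_subset_nonempty {U | IsTheory M Λ U ∧ ψ ∉ U} (by
    intro c hc hchain ⟨U₀, hU₀⟩
    refine ⟨⋃₀ c, ⟨⟨?_, ?_, ?_⟩, ?_⟩, fun s hs => Set.subset_sUnion_of_mem hs⟩
    · exact Set.sUnion_subset fun U hU => (hc hU).1.subset_lang
    · exact (hc hU₀).1.le.trans (Set.subset_sUnion_of_mem hU₀)
    · rintro α β ⟨U, hU, hα⟩ ⟨V, hV, hαβ⟩
      rcases hchain.total hU hV with hUV | hVU
      · exact ⟨V, hV, (hc hV).1.mp _ _ (hUV hα) hαβ⟩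
      · exact ⟨U, hU, (hc hU).1.mp _ _ hα (hVU hαβ)⟩
    · rintro ⟨U, hU, hmem⟩
      exact (hc hU).2 hmem) T ⟨hT, h⟩
  have hPT : IsTheory M Λ P := hP.prop.1
  have hPψ : ψ ∉ P := hP.prop.2
  -- By maximality, the theory generated by `P` and a formula outside `P` must contain `ψ`; with
  -- disjunction elimination this gives primality.
  have key : ∀ α ∈ Lang M, α ∉ P → imp α ψ ∈ P := by
    intro α hα hαP
    by_contra hn
    have := hP.le_of_ge (y := {χ | imp α χ ∈ P}) ⟨hPT.adjoin hΛ hα, hn⟩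
      (fun χ hχ => hPT.weaken hΛ hχ hα)
    exact hαP (this (hPT.imp_self hΛ hα))
  refine ⟨P, ⟨hPT, ?_, ?_⟩, hTP, hPψ⟩
  · intro hbot
    exact hPψ (hPT.mp _ _ hbot (hPT.scheme_mem hΛ
      (by simp [imp_mem_lang, hψ, bot_mem_lang]) (.exFalso ψ)))
  · intro α β hαβ
    by_contra! hn
    have hl := disj_mem_lang.1 (hPT.subset_lang hαβ)
    refine hPψ (hPT.mp _ _ hαβ (hPT.mp _ _ (key β hl.2 hn.2) (hPT.mp _ _ (key α hl.1 hn.1)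
      (hPT.scheme_mem hΛ ?_ (.orElim α β ψ)))))
    simp [imp_mem_lang, disj_mem_lang, hl, hψ]

end IsTheory

namespace IsPrimeTheory

theorem disj_mem (hT : IsPrimeTheory M Λ T) (hΛ : IsAdmissible M Λ) (h : disj φ ψ ∈ Lang M) :
    disj φ ψ ∈ T ↔ φ ∈ T ∨ ψ ∈ T :=
  ⟨hT.prime φ ψ, fun h' => h'.elim (fun h' => hT.disj_mem_left hΛ h' (disj_mem_lang.1 h).2)
    (fun h' => hT.disj_mem_right hΛ h' (disj_mem_lang.1 h).1)⟩

theorem bigOr_mem (hT : IsPrimeTheory M Λ T) (hΛ : IsAdmissible M Λ) {l : List Formula}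
    (hl : ∀ φ ∈ l, φ ∈ Lang M) : bigOr l ∈ T ↔ ∃ φ ∈ l, φ ∈ T := by
  induction l with
  | nil => simpa [bigOr] using hT.bot_notMem
  | cons φ l ih =>
    have hl' : disj φ (bigOr l) ∈ Lang M := by
      simpa [disj_mem_lang, bigOr_mem_lang] using hl
    simp [bigOr, hT.disj_mem hΛ hl', ih fun χ hχ => hl χ (List.mem_cons_of_mem _ hχ)]

/-- The Kripke clause for implication. If `imp φ ψ ∉ T`, the theory generated by `T` and `φ` omits
`ψ`, and `exists_prime` makes it prime. -/
theorem imp_mem (hT : IsPrimeTheory M Λ T) (hΛ : IsAdmissible M Λ) (h : imp φ ψ ∈ Lang M) :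
    imp φ ψ ∈ T ↔ ∀ P, IsPrimeTheory M Λ P → T ⊆ P → φ ∈ P → ψ ∈ P := by
  refine ⟨fun h' P hP hTP hφ => hP.mp _ _ hφ (hTP h'), fun h' => ?_⟩
  by_contra hn
  have hl := imp_mem_lang.1 h
  obtain ⟨P, hP, hTP, hψ⟩ := (hT.adjoin hΛ hl.1).exists_prime hΛ hl.2 hn
  exact hψ (h' P hP (fun χ hχ => hTP (hT.weaken hΛ hχ hl.1)) (hTP (hT.imp_self hΛ hl.1)))

/-- The set of formulas true at the next moment is again a prime theory. -/
theorem preimage_next (hT : IsPrimeTheory M Λ T) (hΛ : IsAdmissible M Λ) :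
    IsPrimeTheory M Λ {φ | next φ ∈ T} where
  subset_lang _ h := next_mem_lang.1 (hT.subset_lang h)
  le _ h := hT.le (hΛ.nec_next _ h)
  mp φ ψ h h' := by
    have hl := hT.subset_lang h'
    refine hT.mp _ _ h (hT.mp _ _ h' (hT.scheme_mem hΛ ?_ (.nextImp φ ψ)))
    simp only [imp_mem_lang, next_mem_lang] at hl ⊢
    tauto
  bot_notMem h := hT.bot_notMem (hT.mp _ _ h (hT.scheme_mem hΛ
    (by simp [imp_mem_lang, next_mem_lang, bot_mem_lang]) .nextBot))
  prime φ ψ h := by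
    have hl := hT.subset_lang h
    refine hT.prime _ _ (hT.mp _ _ h (hT.scheme_mem hΛ ?_ (.nextOr φ ψ)))
    simp only [imp_mem_lang, next_mem_lang, disj_mem_lang] at hl ⊢
    tauto

end IsPrimeTheory

/-! ### Completeness for prime theories and derived temporal principles -/

namespace IsAdmissible

theorem mem_iff_forall_prime (hΛ : IsAdmissible M Λ) (hφ : φ ∈ Lang M) :
    φ ∈ Λ ↔ ∀ T, IsPrimeTheory M Λ T → φ ∈ T := by
  refine ⟨fun h T hT => hT.le h, fun h => ?_⟩
  by_contra hn
  obtain ⟨P, hP, -, hφP⟩ := hΛ.isTheory.exists_prime hΛ hφ hn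
  exact hφP (h P hP)

theorem imp_mem_iff_forall_prime (hΛ : IsAdmissible M Λ) (h : imp φ ψ ∈ Lang M) :
    imp φ ψ ∈ Λ ↔ ∀ T, IsPrimeTheory M Λ T → φ ∈ T → ψ ∈ T := by
  refine ⟨fun h' T hT hφ => hT.mp _ _ hφ (hT.le h'), fun h' => ?_⟩
  rw [hΛ.mem_iff_forall_prime h]
  intro T hT
  rw [hT.imp_mem hΛ h]
  exact fun P hP _ hφ => h' P hP hφ

theorem dia_fix (hΛ : IsAdmissible M Λ) (h : dia φ ∈ Lang M) :
    imp (disj φ (next (dia φ))) (dia φ) ∈ Λ := by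
  have hl := dia_mem_lang.1 h
  exact hΛ.scheme _ (by simp [imp_mem_lang, disj_mem_lang, next_mem_lang, h, hl]) (.diaFix φ)

/-- The converse of the fixpoint axiom. Applying `○` to that axiom shows that `θ = φ ∨ ○◇φ`
satisfies `○θ → θ`, so the induction rule gives `◇θ → θ`. Monotonicity gives `◇φ → ◇θ`. -/
theorem dia_unfold (hΛ : IsAdmissible M Λ) (h : dia φ ∈ Lang M) :
    imp (dia φ) (disj φ (next (dia φ))) ∈ Λ := by
  have hl := dia_mem_lang.1 h
  have hT := hΛ.isTheory
  have hχ : disj φ (next (dia φ)) ∈ Lang M := by simp [disj_mem_lang, next_mem_lang, h, hl]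
  have h₁ : imp (next (disj φ (next (dia φ)))) (next (dia φ)) ∈ Λ :=
    hΛ.mp _ _ (hΛ.nec_next _ (hΛ.dia_fix h))
      (hΛ.scheme _ (by simp [imp_mem_lang, next_mem_lang, h, hχ]) (.nextImp _ _))
  have h₂ : imp (next (disj φ (next (dia φ)))) (disj φ (next (dia φ))) ∈ Λ :=
    hT.imp_trans hΛ h₁
      (hΛ.scheme _ (by simp [imp_mem_lang, disj_mem_lang, next_mem_lang, h, hl]) (.orRight _ _))
  have h₃ : imp φ (disj φ (next (dia φ))) ∈ Λ :=
    hΛ.scheme _ (by simp [imp_mem_lang, disj_mem_lang, next_mem_lang, h, hl]) (.orLeft _ _)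
  exact hT.imp_trans hΛ (hΛ.dia_mono hl.1 _ _ h₃) (hΛ.dia_ind hl.1 _ h₂)

theorem all_iff_next (hΛ : IsAdmissible M Λ) (hT : IsTheory M Λ T) (h : all φ ∈ Lang M) :
    all φ ∈ T ↔ next (all φ) ∈ T := by
  have := hT.scheme_mem hΛ (φ := iff (all φ) (next (all φ)))
    (by simp [iff, conj_mem_lang, imp_mem_lang, next_mem_lang, h]) (.allNext φ)
  rw [iff, hT.conj_mem hΛ] at this
  exact ⟨fun h => hT.mp _ _ h this.1, fun h => hT.mp _ _ h this.2⟩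

end IsAdmissible

end Theory

/-! ### The canonical structure -/

/-- The canonical structure of `Λ`, whose points are the prime theories over `Λ`. -/
def canonicalStructure (M : Set Modality) (Λ : Set Formula) : LabelledStructure.{0} where
  -- The order, supplied by instance search, is inclusion of theories.
  World := {T : Set Formula // IsPrimeTheory M Λ T}
  succ T P := P.1 = {φ | next φ ∈ T.1}
  label T := ⟨T.1, Lang M \ T.1⟩

section Canonical

variable {M : Set Modality} {Λ : Set Formula}

theorem canonicalStructure_deterministic (hΛ : IsAdmissible M Λ) :
    (canonicalStructure M Λ).Deterministic := fun T =>
  ⟨⟨_, T.2.preimage_next hΛ⟩, rfl, fun _ h => Subtype.ext h⟩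

theorem canonicalStructure_isSaturated :
    (canonicalStructure M Λ).IsSaturated (Lang M) := fun T =>
  (Set.sdiff_union_of_subset T.2.subset_lang).symm

theorem canonicalStructure_isType (hΛ : IsAdmissible M Λ) (T : (canonicalStructure M Λ).World) :
    ((canonicalStructure M Λ).label T).IsType (Lang M) := by
  obtain ⟨T, hT⟩ := T
  constructor <;> simp only [canonicalStructure]
  · exact hT.subset_lang
  · exact Set.sdiff_subset
  · exact Set.sdiff_inter_self
  · exact hT.bot_notMem
  · intro φ ψ h
    exact (hT.conj_mem hΛ).1 h
  · rintro φ ψ ⟨h, h'⟩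
    rw [conj_mem_lang] at h
    rw [hT.conj_mem hΛ] at h'
    simp only [Set.mem_sdiff]
    tauto
  · exact hT.prime
  · rintro φ ψ ⟨h, h'⟩
    rw [hT.disj_mem hΛ h] at h'
    rw [disj_mem_lang] at h
    simp only [Set.mem_sdiff]
    tauto
  · intro φ ψ h
    have hl := imp_mem_lang.1 (hT.subset_lang h)
    by_cases hφ : φ ∈ T
    · exact Or.inr (hT.mp _ _ hφ h)
    · exact Or.inl ⟨hl.1, hφ⟩
  · rintro φ ψ ⟨h, h'⟩
    have hl := imp_mem_lang.1 h
    exact ⟨hl.2, fun hψ => h' (hT.weaken hΛ hψ hl.1)⟩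
  · rintro φ ⟨h, h'⟩
    have hl := dia_mem_lang.1 h
    exact ⟨hl.2, fun hφ => h' (hT.mp _ _
      (hT.disj_mem_left hΛ hφ (next_mem_lang.2 h)) (hT.le (hΛ.dia_fix h)))⟩

/-- Defects are revoked by the Kripke clause for implication. Confluence holds because the successor
map is monotone for inclusion. Sensibility comes from both directions of the fixpoint equivalence
for `◇` and from `∀φ ↔ ○∀φ`. -/
theorem canonicalStructure_isWeakQuasimodel (hΛ : IsAdmissible M Λ) :
    (canonicalStructure M Λ).IsWeakQuasimodel (Lang M) where
  frame :=
    { isType := canonicalStructure_isType hΛ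
      mono := fun T P h => ⟨Set.sdiff_subset_sdiff_right h, h⟩
      revoke := by
        rintro ⟨T, hT⟩ φ ψ ⟨⟨h, h'⟩, -⟩
        have hl := imp_mem_lang.1 h
        have h'' : ¬ imp φ ψ ∈ T := h'
        rw [hT.imp_mem hΛ h] at h''
        push Not at h''
        obtain ⟨P, hP, hTP, hφ, hψ⟩ := h''
        exact ⟨⟨P, hP⟩, hTP, hφ, hl.2, hψ⟩ }
  continuous := by
    rintro ⟨T, hT⟩ ⟨T', hT'⟩ ⟨P, hP⟩ hle h
    obtain rfl : P = _ := h
    exact ⟨⟨_, hT'.preimage_next hΛ⟩, fun φ hφ => hle hφ, rfl⟩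
  sensible := by
    rintro ⟨T, hT⟩ ⟨P, hP⟩ h
    obtain rfl : P = _ := h
    constructor <;> simp only [canonicalStructure]
    · exact fun φ h => h
    · exact fun φ h => ⟨next_mem_lang.1 h.1, h.2⟩
    · intro φ h
      exact hT.prime _ _ (hT.mp _ _ h (hT.le (hΛ.dia_unfold (hT.subset_lang h))))
    · rintro φ ⟨h, h'⟩
      refine ⟨h, fun hn => h' (hT.mp _ _ (hT.disj_mem_right hΛ hn (dia_mem_lang.1 h).2)
        (hT.le (hΛ.dia_fix h)))⟩
    · intro φ
      exact ⟨fun h => (hΛ.all_iff_next hT.toIsTheory (hT.subset_lang h)).1 h,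
        fun h => (hΛ.all_iff_next hT.toIsTheory (hP.subset_lang h)).2 h⟩
    · intro φ
      exact and_congr_right fun h => not_congr (hΛ.all_iff_next hT.toIsTheory h)

end Canonical

/-! ### Simulations and simulation formulas -/

namespace LabelledStructure

/-- A union of simulations is a simulation. -/
theorem isSimulation_simulates (X : LabelledStructure.{u}) (Y : LabelledStructure.{v}) :
    IsSimulation X Y (Simulates X Y) where
  continuous := by
    rintro x x' y hx ⟨E, hE, hxy⟩
    obtain ⟨y', hy, h⟩ := hE.continuous x x' y hx hxy
    exact ⟨y', hy, E, hE, h⟩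
  label := by
    rintro x y ⟨E, hE, hxy⟩
    exact hE.label x y hxy

/-- To simulate `y` by `x` it suffices that every point above `x` simulates some point above
`y`. -/
theorem Simulates.of_lt {X : LabelledStructure.{u}} {Y : LabelledStructure.{v}} {x : X.World}
    {y : Y.World} (hl : (X.label x).Sub (Y.label y))
    (h : ∀ x', x < x' → ∃ y', y ≤ y' ∧ Simulates X Y x' y') : Simulates X Y x y := by
  have hs := isSimulation_simulates X Y
  -- The largest simulation with the single pair `(x, y)` adjoined.
  refine ⟨fun a b => Simulates X Y a b ∨ a = x ∧ b = y, ⟨?_, ?_⟩, Or.inr ⟨rfl, rfl⟩⟩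
  · rintro a a' b ha (hab | ⟨rfl, rfl⟩)
    · obtain ⟨b', hb, h'⟩ := hs.continuous a a' b ha hab
      exact ⟨b', hb, Or.inl h'⟩
    · rcases ha.eq_or_lt with rfl | ha
      · exact ⟨b, le_rfl, Or.inr ⟨rfl, rfl⟩⟩
      · obtain ⟨y', hy, h'⟩ := h a' ha
        exact ⟨y', hy, Or.inl h'⟩
  · rintro a b (hab | ⟨rfl, rfl⟩)
    · exact hs.label a b hab
    · exact hl

/-! ### Simulation formulas at prime theories -/

section Sim

variable {M : Set Modality} {Λ : Set Formula} {Sig : Finset Formula} {I : LabelledStructure.{u}}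
  [Finite I.World]

theorem sim_mem_lang (hSig : (Sig : Set Formula) ⊆ Lang M) (w : I.World) :
    Sim Sig I w ∈ Lang M := by
  induction w using (wellFounded_gt (α := I.World)).induction with
  | _ w ih =>
    rw [Sim, imp_mem_lang, disj_mem_lang, bigAnd_mem_lang, bigOr_mem_lang, bigOr_mem_lang]
    refine ⟨fun φ hφ => hSig ?_, fun φ hφ => hSig ?_, fun φ hφ => ?_⟩
    · simp only [Finset.mem_toList, Finset.mem_filter] at hφ
      exact hφ.1
    · simp only [Finset.mem_toList, Finset.mem_filter] at hφ
      exact hφ.1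
    · simp only [List.mem_map] at hφ
      obtain ⟨v, -, rfl⟩ := hφ
      refine ih v.1 ?_
      have h := v.2
      simpa only [Set.Finite.mem_toFinset, Set.mem_ofPred_eq] using h

theorem sim_mem_iff (hΛ : IsAdmissible M Λ) (hSig : (Sig : Set Formula) ⊆ Lang M) {T : Set Formula}
    (hT : IsPrimeTheory M Λ T) (w : I.World) :
    Sim Sig I w ∈ T ↔ ∀ P, IsPrimeTheory M Λ P → T ⊆ P →
      (∀ φ ∈ Sig, φ ∈ (I.label w).pos → φ ∈ P) →
      (∃ φ ∈ Sig, φ ∈ (I.label w).neg ∧ φ ∈ P) ∨ ∃ v, w < v ∧ Sim Sig I v ∈ P := by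
  have hl := sim_mem_lang hSig w
  rw [Sim] at hl ⊢
  rw [hT.imp_mem hΛ hl]
  refine forall_congr' fun P => forall_congr' fun hP => forall_congr' fun _ => ?_
  rw [imp_mem_lang, disj_mem_lang, bigOr_mem_lang, bigOr_mem_lang] at hl
  rw [hP.bigAnd_mem hΛ, hP.disj_mem hΛ (by
    rw [disj_mem_lang, bigOr_mem_lang, bigOr_mem_lang]; exact hl.2), hP.bigOr_mem hΛ hl.2.1,
    hP.bigOr_mem hΛ hl.2.2]
  simp [and_assoc]

/-- The simulation formula of `w` fails at a prime theory if and only if `w` simulates some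
extension of it. -/
theorem sim_notMem_iff (hΛ : IsAdmissible M Λ) (hSig : (Sig : Set Formula) ⊆ Lang M)
    (hI : I.IsLabelledFrame (Sig : Set Formula)) (w : I.World)
    (T : (canonicalStructure M Λ).World) :
    Sim Sig I w ∉ T.1 ↔ ∃ P, T ≤ P ∧ Simulates I (canonicalStructure M Λ) w P := by
  induction w using (wellFounded_gt (α := I.World)).induction generalizing T with
  | _ w ih =>
    rw [sim_mem_iff hΛ hSig T.2]
    push Not
    constructor
    -- The label condition holds at `P` itself. By induction each `v` above `w` simulates an
    -- extension of `P`, which is what `Simulates.of_lt` requires.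
    · rintro ⟨P, hP, hTP, hpos, hneg, hv⟩
      refine ⟨⟨P, hP⟩, hTP, Simulates.of_lt ⟨fun φ hφ => ?_, fun φ hφ => ?_⟩ fun v hwv =>
        (ih v hwv ⟨P, hP⟩).1 (hv v hwv)⟩
      · have hφS := (hI.isType w).neg_subset hφ
        exact ⟨hSig hφS, hneg φ hφS hφ⟩
      · exact hpos φ ((hI.isType w).pos_subset hφ) hφ
    · rintro ⟨P, hTP, hwP⟩
      have hs := isSimulation_simulates I (canonicalStructure M Λ)
      refine ⟨P.1, P.2, hTP, fun φ _ hφ => (hs.label w P hwP).2 hφ,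
        fun φ _ hφ => ((hs.label w P hwP).1 hφ).2, fun v hwv => ?_⟩
      exact (ih v hwv P).2 (hs.continuous w v P hwv.le hwP)

theorem mem_possible_iff (hΛ : IsAdmissible M Λ) (hSig : (Sig : Set Formula) ⊆ Lang M)
    (hI : I.IsLabelledFrame (Sig : Set Formula)) (w : I.World) :
    w ∈ possible Λ Sig I ↔ ∃ T, Simulates I (canonicalStructure M Λ) w T := by
  change Sim Sig I w ∉ Λ ↔ _
  rw [hΛ.mem_iff_forall_prime (sim_mem_lang hSig w)]
  push Not
  constructor
  · rintro ⟨T, hT, h⟩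
    obtain ⟨P, -, hP⟩ := (sim_notMem_iff hΛ hSig hI w ⟨T, hT⟩).1 h
    exact ⟨P, hP⟩
  · rintro ⟨T, h⟩
    exact ⟨T.1, T.2, (sim_notMem_iff hΛ hSig hI w T).2 ⟨T, le_rfl, h⟩⟩

end Sim

/-! ### Restrictions to up-sets -/

/-- Being an up-set keeps the points that revoke defects and the witnesses of confluence inside `U`.
-/
theorem IsWeakQuasimodel.restrict {Δ : Set Formula} {W : LabelledStructure.{u}}
    (hW : W.IsWeakQuasimodel Δ) {U : Set W.World} (hU : ∀ w v, w ≤ v → w ∈ U → v ∈ U) :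
    (W.restrict U).IsWeakQuasimodel Δ where
  frame :=
    { isType := fun w => hW.frame.isType w.1
      mono := fun w v h => hW.frame.mono w.1 v.1 h
      revoke := fun w φ ψ h => by
        obtain ⟨v, hv, h'⟩ := hW.frame.revoke w.1 φ ψ h
        exact ⟨⟨v, hU _ _ hv w.2⟩, hv, h'⟩ }
  continuous := fun w w' v hle h => by
    obtain ⟨v', hv, h'⟩ := hW.continuous w.1 w'.1 v.1 hle h
    exact ⟨⟨v', hU _ _ hv v.2⟩, hv, h'⟩
  sensible := fun w v h => hW.sensible w.1 v.1 h

/-! ### The initial structure -/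

section InitialStructure

variable {M : Set Modality} {Λ : Set Formula} {Sig : Finset Formula} {I : LabelledStructure.{u}}

/-- The only appeal to initiality, with `Δ` the whole language. The canonical structure lives in
universe 0, whence the second universe level. -/
theorem IsInitial.isDynamic_canonicalStructure (hI : IsInitial.{u, 0} Sig I)
    (hΛ : IsAdmissible M Λ) (hSig : (Sig : Set Formula) ⊆ Lang M) :
    IsDynamic I (canonicalStructure M Λ) (Simulates I (canonicalStructure M Λ)) :=
  (hI.universal (Lang M) (canonicalStructure M Λ) hSig (subClosed_lang M)
    (canonicalStructure_isWeakQuasimodel hΛ) canonicalStructure_isSaturated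
    (canonicalStructure_deterministic hΛ)).2.1

variable [Finite I.World]

theorem IsInitial.initialStructure_isWeakQuasimodel (hI : IsInitial.{u, 0} Sig I)
    (hΛ : IsAdmissible M Λ) (hSig : (Sig : Set Formula) ⊆ Lang M) :
    (I.initialStructure Λ Sig).IsWeakQuasimodel (Sig : Set Formula) := by
  refine hI.weak.restrict fun w v hwv hw => ?_
  rw [mem_possible_iff hΛ hSig hI.weak.frame] at hw ⊢
  obtain ⟨T, hT⟩ := hw
  obtain ⟨P, -, hP⟩ := (isSimulation_simulates I _).continuous w v T hwv hT
  exact ⟨P, hP⟩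

theorem IsInitial.initialStructure_serial (hI : IsInitial.{u, 0} Sig I)
    (hΛ : IsAdmissible M Λ) (hSig : (Sig : Set Formula) ⊆ Lang M) :
    (I.initialStructure Λ Sig).Serial := by
  rintro ⟨w, hw⟩
  obtain ⟨T, hT⟩ := (mem_possible_iff hΛ hSig hI.weak.frame w).1 hw
  obtain ⟨P, hP, -⟩ := canonicalStructure_deterministic hΛ T
  obtain ⟨v, hwv, hv⟩ := hI.isDynamic_canonicalStructure hΛ hSig w T P hT hP
  exact ⟨⟨v, (mem_possible_iff hΛ hSig hI.weak.frame v).2 ⟨P, hv⟩⟩, hwv⟩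

theorem IsInitial.initialStructure_omegaSensible (hI : IsInitial.{u, 0} Sig I)
    (hΛ : IsAdmissible M Λ) (hSig : (Sig : Set Formula) ⊆ Lang M)
    (hsub : SubClosed (Sig : Set Formula)) :
    (I.initialStructure Λ Sig).OmegaSensible := by
  classical
  have hF := hI.weak.frame
  refine ⟨hI.initialStructure_serial hΛ hSig, fun w φ hφ => ?_⟩
  by_contra! hn
  have hdia : dia φ ∈ Sig := (hF.isType w.1).pos_subset hφ
  have hφSig : φ ∈ Sig := hsub _ hdia (by simp [sub, self_mem_sub])
  have hM := (dia_mem_lang.1 (hSig hdia)).1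
  let R : Set I.World :=
    {v | ∃ h, Relation.ReflTransGen (I.initialStructure Λ Sig).succ w ⟨v, h⟩}
  let χ := bigAnd ((Set.toFinite R).toFinset.toList.map (Sim Sig I))
  have hχ : χ ∈ Lang M := by
    simp only [χ, bigAnd_mem_lang, List.mem_map]
    rintro _ ⟨v, -, rfl⟩
    exact sim_mem_lang hSig v
  have mem_χ : ∀ T, IsPrimeTheory M Λ T → (χ ∈ T ↔ ∀ v ∈ R, Sim Sig I v ∈ T) := by
    intro T hT
    simp [χ, hT.bigAnd_mem hΛ]
  -- If `Sim v` failed at `T`, then `v` would simulate some `P ⊇ T`. Dynamicity then gives a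
  -- reachable `x` that simulates the successor `Q` of `P`. So `Sim x` fails at `Q`, although `χ ∈
  -- Q`.
  have h₁ : imp (next χ) χ ∈ Λ := by
    rw [hΛ.imp_mem_iff_forall_prime (by simp [imp_mem_lang, next_mem_lang, hχ])]
    intro T hT hnext
    rw [mem_χ T hT]
    rintro v ⟨hv, hwv⟩
    by_contra hvT
    obtain ⟨P, hTP, hvP⟩ := (sim_notMem_iff hΛ hSig hF v ⟨T, hT⟩).1 hvT
    obtain ⟨Q, hPQ, -⟩ := canonicalStructure_deterministic hΛ P
    obtain ⟨x, hvx, hxQ⟩ := hI.isDynamic_canonicalStructure hΛ hSig v P Q hvP hPQ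
    have hx := (mem_possible_iff hΛ hSig hF x).2 ⟨Q, hxQ⟩
    refine (sim_notMem_iff hΛ hSig hF x Q).2 ⟨Q, le_rfl, hxQ⟩
      ((mem_χ Q.1 Q.2).1 ?_ x ⟨hx, hwv.tail hvx⟩)
    have hPQ' : Q.1 = {φ | next φ ∈ P.1} := hPQ
    rw [hPQ']
    exact hTP hnext
  -- By saturation `φ` is negative at each reachable `v`, so no prime theory simulated by `v`
  -- contains `φ`.
  have h₂ : imp φ χ ∈ Λ := by
    rw [hΛ.imp_mem_iff_forall_prime (by simp [imp_mem_lang, hSig hφSig, hχ])]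
    intro T hT hφT
    rw [mem_χ T hT]
    rintro v ⟨hv, hwv⟩
    by_contra hvT
    obtain ⟨P, hTP, hvP⟩ := (sim_notMem_iff hΛ hSig hF v ⟨T, hT⟩).1 hvT
    have hneg : φ ∈ (I.label v).neg := by
      have hsat : φ ∈ (I.label v).neg ∪ (I.label v).pos := hI.saturated v ▸ hφSig
      exact hsat.resolve_right (hn ⟨v, hv⟩ hwv)
    exact (((isSimulation_simulates I _).label v P hvP).1 hneg).2 (hTP hφT)
  have h₃ : imp (dia φ) χ ∈ Λ :=
    hΛ.isTheory.imp_trans hΛ (hΛ.dia_mono hM _ _ h₂) (hΛ.dia_ind hM _ h₁)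
  obtain ⟨T, hwT⟩ := (mem_possible_iff hΛ hSig hF w.1).1 w.2
  refine (sim_notMem_iff hΛ hSig hF w.1 T).2 ⟨T, le_rfl, hwT⟩
    ((mem_χ T.1 T.2).1 ?_ w.1 ⟨w.2, .refl⟩)
  exact T.2.mp _ _ (((isSimulation_simulates I _).label w.1 T hwT).2 hφ) (T.2.le h₃)

/-- Labels by types without formulas `∀ φ` are honest. -/
theorem honest_of_all_notMem {Δ : Set Formula} {W : LabelledStructure.{u}}
    (hW : W.IsLabelledFrame Δ) (h : ∀ φ, all φ ∉ Δ) : W.Honest := fun w φ =>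
  ⟨fun h' => (h φ ((hW.isType w).pos_subset h')).elim,
    fun h' => (h φ ((hW.isType w).neg_subset h')).elim⟩

end InitialStructure

end LabelledStructure

/-! ### Restriction of types -/

section SubClosed

variable {Γ : Set Formula}

theorem SubClosed.conj_mem {φ ψ : Formula} (h : SubClosed Γ) (h' : conj φ ψ ∈ Γ) :
    φ ∈ Γ ∧ ψ ∈ Γ :=
  ⟨h _ h' (by simp [sub, self_mem_sub]), h _ h' (by simp [sub, self_mem_sub])⟩

theorem SubClosed.disj_mem {φ ψ : Formula} (h : SubClosed Γ) (h' : disj φ ψ ∈ Γ) :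
    φ ∈ Γ ∧ ψ ∈ Γ :=
  ⟨h _ h' (by simp [sub, self_mem_sub]), h _ h' (by simp [sub, self_mem_sub])⟩

theorem SubClosed.imp_mem {φ ψ : Formula} (h : SubClosed Γ) (h' : imp φ ψ ∈ Γ) :
    φ ∈ Γ ∧ ψ ∈ Γ :=
  ⟨h _ h' (by simp [sub, self_mem_sub]), h _ h' (by simp [sub, self_mem_sub])⟩

theorem SubClosed.next_mem {φ : Formula} (h : SubClosed Γ) (h' : next φ ∈ Γ) : φ ∈ Γ :=
  h _ h' (by simp [sub, self_mem_sub])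

theorem SubClosed.dia_mem {φ : Formula} (h : SubClosed Γ) (h' : dia φ ∈ Γ) : φ ∈ Γ :=
  h _ h' (by simp [sub, self_mem_sub])

end SubClosed

namespace TwoSided

/-- The restriction of a two-sided set to a set of formulas. -/
def restrict (Φ : TwoSided) (Δ : Set Formula) : TwoSided := ⟨Φ.pos ∩ Δ, Φ.neg ∩ Δ⟩

variable {Φ Ψ : TwoSided} {Δ Γ : Set Formula}

theorem IsType.restrict (hΦ : Φ.IsType Δ) (hΓ : SubClosed Γ) : (Φ.restrict Γ).IsType Γ where
  pos_subset := Set.inter_subset_right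
  neg_subset := Set.inter_subset_right
  inter := by
    have := hΦ.inter
    simp only [TwoSided.restrict, Set.ext_iff, Set.mem_inter_iff, Set.mem_empty_iff_false] at this ⊢
    exact fun x => ⟨fun hx => (this x).1 ⟨hx.1.1, hx.2.1⟩, False.elim⟩
  bot_pos h := hΦ.bot_pos h.1
  and_pos φ ψ h := by
    have h₁ := hΦ.and_pos φ ψ h.1
    have h₂ := hΓ.conj_mem h.2
    exact ⟨⟨h₁.1, h₂.1⟩, h₁.2, h₂.2⟩
  and_neg φ ψ h := by
    have h₂ := hΓ.conj_mem h.2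
    exact (hΦ.and_neg φ ψ h.1).imp (⟨·, h₂.1⟩) (⟨·, h₂.2⟩)
  or_pos φ ψ h := by
    have h₂ := hΓ.disj_mem h.2
    exact (hΦ.or_pos φ ψ h.1).imp (⟨·, h₂.1⟩) (⟨·, h₂.2⟩)
  or_neg φ ψ h := by
    have h₁ := hΦ.or_neg φ ψ h.1
    have h₂ := hΓ.disj_mem h.2
    exact ⟨⟨h₁.1, h₂.1⟩, h₁.2, h₂.2⟩
  imp_pos φ ψ h := by
    have h₂ := hΓ.imp_mem h.2
    exact (hΦ.imp_pos φ ψ h.1).imp (⟨·, h₂.1⟩) (⟨·, h₂.2⟩)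
  imp_neg φ ψ h := ⟨hΦ.imp_neg φ ψ h.1, (hΓ.imp_mem h.2).2⟩
  dia_neg φ h := ⟨hΦ.dia_neg φ h.1, hΓ.dia_mem h.2⟩

theorem Saturated.restrict (hΦ : Φ.Saturated Δ) (h : Γ ⊆ Δ) : (Φ.restrict Γ).Saturated Γ := by
  change Γ = Φ.neg ∩ Γ ∪ Φ.pos ∩ Γ
  have hΦ' : Δ = Φ.neg ∪ Φ.pos := hΦ
  rw [← Set.union_inter_distrib_right, ← hΦ', Set.inter_eq_right.2 h]

theorem Le.restrict (h : Φ.Le Ψ) : (Φ.restrict Γ).Le (Ψ.restrict Γ) :=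
  ⟨Set.inter_subset_inter_left _ h.1, Set.inter_subset_inter_left _ h.2⟩

theorem Sensible.restrict (h : Φ.Sensible Ψ) (hΓ : SubClosed Γ) :
    (Φ.restrict Γ).Sensible (Ψ.restrict Γ) where
  next_pos φ h' := ⟨h.next_pos φ h'.1, hΓ.next_mem h'.2⟩
  next_neg φ h' := ⟨h.next_neg φ h'.1, hΓ.next_mem h'.2⟩
  dia_pos φ h' := (h.dia_pos φ h'.1).imp (⟨·, hΓ.dia_mem h'.2⟩) (⟨·, h'.2⟩)
  dia_neg φ h' := ⟨h.dia_neg φ h'.1, h'.2⟩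
  all_pos φ := and_congr_left fun _ => h.all_pos φ
  all_neg φ := and_congr_left fun _ => h.all_neg φ

theorem Le.refl (Φ : TwoSided) : Φ.Le Φ := ⟨subset_rfl, subset_rfl⟩

theorem Le.trans {Θ : TwoSided} (h : Φ.Le Ψ) (h' : Ψ.Le Θ) : Φ.Le Θ :=
  ⟨h'.1.trans h.1, h.2.trans h'.2⟩

theorem restrict_sub : (Φ.restrict Γ).Sub Φ := ⟨Set.inter_subset_left, Set.inter_subset_left⟩

/-- A saturated type included in another type is its restriction. -/
theorem Sub.eq_restrict (h : Φ.Sub Ψ) (hΦ : Φ.IsType Γ) (hs : Φ.Saturated Γ)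
    (hΨ : Ψ.IsType Δ) : Φ = Ψ.restrict Γ := by
  have hdisj : ∀ φ, φ ∈ Ψ.neg → φ ∉ Ψ.pos := fun φ h₁ h₂ =>
    (hΨ.inter ▸ (⟨h₁, h₂⟩ : φ ∈ Ψ.neg ∩ Ψ.pos) : φ ∈ (∅ : Set Formula))
  have hmem : ∀ φ ∈ Γ, φ ∈ Φ.neg ∨ φ ∈ Φ.pos := fun φ hφ => by
    rw [hs] at hφ
    exact hφ
  ext φ
  · exact ⟨fun hφ => ⟨h.2 hφ, hΦ.pos_subset hφ⟩, fun hφ =>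
      (hmem φ hφ.2).resolve_left fun h' => hdisj φ (h.1 h') hφ.1⟩
  · exact ⟨fun hφ => ⟨h.1 hφ, hΦ.neg_subset hφ⟩, fun hφ =>
      (hmem φ hφ.2).resolve_right fun h' => hdisj φ hφ.1 (h.2 h')⟩

open Classical in
/-- The number of formulas of `Sig` that are not positive in `Φ`. -/
noncomputable def corank (Sig : Finset Formula) (Φ : TwoSided) : ℕ :=
  (Sig.filter (fun φ => φ ∉ Φ.pos)).card

theorem corank_restrict (Sig : Finset Formula) (Φ : TwoSided) :
    (Φ.restrict Sig).corank Sig = Φ.corank Sig := by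
  classical
  unfold corank
  congr 1
  ext φ
  simp only [Finset.mem_filter, restrict, Set.mem_inter_iff, Finset.mem_coe]
  tauto

/-- Among saturated types, `≼_T` either is an equality or decreases the corank. -/
theorem Le.eq_or_corank_lt {Sig : Finset Formula} (h : Φ.Le Ψ)
    (hΦ : Φ.IsType (Sig : Set Formula)) (hΨ : Ψ.IsType (Sig : Set Formula))
    (hsΨ : Ψ.Saturated (Sig : Set Formula)) : Φ = Ψ ∨ Ψ.corank Sig < Φ.corank Sig := by
  classical
  -- With equal positive parts, saturation of `Ψ` forces equal negative parts.
  by_cases hpos : Ψ.pos ⊆ Φ.pos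
  · refine Or.inl (TwoSided.ext (h.2.antisymm hpos) (Set.Subset.antisymm (fun φ hφ => ?_) h.1))
    have hφS : φ ∈ Ψ.neg ∪ Ψ.pos := hsΨ ▸ hΦ.neg_subset hφ
    exact hφS.resolve_right fun h' =>
      (hΦ.inter ▸ (⟨hφ, hpos h'⟩ : φ ∈ Φ.neg ∩ Φ.pos) : φ ∈ (∅ : Set Formula))
  · right
    obtain ⟨φ, hφ, hφ'⟩ := Set.not_subset.1 hpos
    refine Finset.card_lt_card (Finset.ssubset_iff_of_subset ?_ |>.2
      ⟨φ, by simpa using ⟨hΨ.pos_subset hφ, hφ'⟩, by simp [hφ]⟩)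
    intro ψ hψ
    simp only [Finset.mem_filter] at hψ ⊢
    exact ⟨hψ.1, fun h' => hψ.2 (h.2 h')⟩

theorem finite_setOf_isType (Sig : Finset Formula) :
    {Φ : TwoSided | Φ.IsType (Sig : Set Formula)}.Finite := by
  refine (Set.Finite.image (fun p : Set Formula × Set Formula => TwoSided.mk p.1 p.2)
    (Sig.finite_toSet.finite_subsets.prod Sig.finite_toSet.finite_subsets)).subset ?_
  intro Φ hΦ
  exact ⟨(Φ.pos, Φ.neg), ⟨hΦ.pos_subset, hΦ.neg_subset⟩, rfl⟩

end TwoSided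
/-! ### Moments -/

namespace LTree

variable {Sig : Finset Formula}

theorem subtree_node_iff {Φ : TwoSided} {n : ℕ} {child : Fin n → LTree} {s : LTree} :
    Subtree (node Φ n child) s ↔ s = node Φ n child ∨ ∃ i, Subtree (child i) s := by
  constructor
  · intro h
    cases h with
    | refl => exact Or.inl rfl
    | step _ _ _ i _ h => exact Or.inr ⟨i, h⟩
  · rintro (rfl | ⟨i, h⟩)
    · exact .refl _
    · exact .step _ _ _ i _ h

theorem IsMoment.isType_root {t : LTree} (h : IsMoment Sig t) :
    (root t).IsType (Sig : Set Formula) := by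
  cases t
  exact h.1

theorem IsMoment.saturated_root {t : LTree} (h : IsMoment Sig t) :
    (root t).Saturated (Sig : Set Formula) := by
  cases t
  exact h.2.1

theorem IsMoment.subtree {t s : LTree} (h : IsMoment Sig t) (hs : Subtree t s) :
    IsMoment Sig s := by
  induction hs with
  | refl => exact h
  | step Φ n child i s _ ih => exact ih (h.2.2.2.2.2 i)

theorem IsMoment.root_le {t s : LTree} (h : IsMoment Sig t) (hs : Subtree t s) :
    (root t).Le (root s) := by
  induction hs with
  | refl => exact .refl _
  | step Φ n child i s _ ih => exact (h.2.2.2.1 i).1.trans (ih (h.2.2.2.2.2 i))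

theorem IsMoment.revoke {t : LTree} (h : IsMoment Sig t) {φ ψ : Formula}
    (hd : (root t).Defect φ ψ) : ∃ s, Subtree t s ∧ (root s).Revokes φ ψ := by
  cases t with
  | node Φ n child =>
    obtain ⟨i, s, hs, h'⟩ := h.2.2.2.2.1 φ ψ hd
    exact ⟨s, .step _ _ _ i _ hs, h'⟩

/-- Children have strictly smaller corank, so by induction they come from a finite set `F`. Being
distinct, they number at most `Nat.card F`, so a root label and a bounded tuple from `F` determine
the moment. -/
theorem finite_setOf_isMoment_corank_lt (Sig : Finset Formula) (k : ℕ) :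
    {t | IsMoment Sig t ∧ (root t).corank Sig < k}.Finite := by
  induction k with
  | zero => simp
  | succ k ih =>
    have := ih.to_subtype
    have := (TwoSided.finite_setOf_isType Sig).to_subtype
    let F := {t | IsMoment Sig t ∧ (root t).corank Sig < k}
    refine (Set.finite_range (fun p : {Φ : TwoSided | Φ.IsType (Sig : Set Formula)} ×
      (Σ n : Fin (Nat.card F + 1), Fin n → F) =>
        node p.1.1 p.2.1 fun i => (p.2.2 i).1)).subset ?_
    rintro ⟨Φ, n, child⟩ ⟨⟨hΦ, hsat, hinj, hle, hdef, hchild⟩, hk⟩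
    have hF : ∀ i, child i ∈ F := fun i => by
      refine ⟨hchild i, ?_⟩
      have := ((hle i).1.eq_or_corank_lt hΦ (hchild i).isType_root
        (hchild i).saturated_root).resolve_left (hle i).2
      have hk' : Φ.corank Sig < k + 1 := hk
      omega
    have hn : n ≤ Nat.card F := by
      have := Nat.card_le_card_of_injective (fun i => (⟨child i, hF i⟩ : F))
        fun i j hij => hinj (congrArg Subtype.val hij)
      simpa using this
    exact ⟨⟨⟨Φ, hΦ⟩, ⟨⟨n, by omega⟩, fun i => ⟨child i, hF i⟩⟩⟩, rfl⟩

theorem finite_setOf_isMoment (Sig : Finset Formula) : {t | IsMoment Sig t}.Finite := by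
  refine (finite_setOf_isMoment_corank_lt Sig (Sig.card + 1)).subset fun t ht => ⟨ht, ?_⟩
  classical
  exact Nat.lt_succ_of_le (Finset.card_le_card (Finset.filter_subset _ _))

open Classical in
/-- The tree with root label `Φ` whose immediate subtrees are the members of the finite set `S`
(without repetition). -/
noncomputable def ofSet (Φ : TwoSided) (S : Set LTree) : LTree :=
  if h : S.Finite then node Φ h.toFinset.card fun i => (h.toFinset.equivFin.symm i).1
  -- A default value, which lets `momentTree` be defined before its set of children is known to be
  -- finite.
  else node Φ 0 Fin.elim0

variable {Φ : TwoSided} {S : Set LTree}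

theorem root_ofSet : root (ofSet Φ S) = Φ := by
  unfold ofSet
  split_ifs <;> rfl

theorem subtree_ofSet_iff (hS : S.Finite) {s : LTree} :
    Subtree (ofSet Φ S) s ↔ s = ofSet Φ S ∨ ∃ t ∈ S, Subtree t s := by
  rw [ofSet, dif_pos hS, subtree_node_iff]
  refine or_congr_right ⟨fun ⟨i, h⟩ => ⟨_, ?_, h⟩, fun ⟨t, ht, h⟩ =>
    ⟨hS.toFinset.equivFin ⟨t, by simpa using ht⟩, by simpa using h⟩⟩
  simpa only [Set.Finite.mem_toFinset] using (hS.toFinset.equivFin.symm i).2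

theorem isMoment_ofSet (hS : S.Finite) (hΦ : Φ.IsType (Sig : Set Formula))
    (hsat : Φ.Saturated (Sig : Set Formula)) (hmom : ∀ t ∈ S, IsMoment Sig t)
    (hle : ∀ t ∈ S, Φ.Le (root t) ∧ Φ ≠ root t)
    (hdef : ∀ φ ψ, Φ.Defect φ ψ → ∃ t ∈ S, ∃ s, Subtree t s ∧ (root s).Revokes φ ψ) :
    IsMoment Sig (ofSet Φ S) := by
  have hmem : ∀ i, (hS.toFinset.equivFin.symm i).1 ∈ S := fun i => by
    simpa only [Set.Finite.mem_toFinset] using (hS.toFinset.equivFin.symm i).2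
  rw [ofSet, dif_pos hS]
  refine ⟨hΦ, hsat, Subtype.val_injective.comp (Equiv.injective _), fun i => hle _ (hmem i),
    fun φ ψ h => ?_, fun i => hmom _ (hmem i)⟩
  obtain ⟨t, ht, h'⟩ := hdef φ ψ h
  exact ⟨hS.toFinset.equivFin ⟨t, by simpa using ht⟩, by simpa using h'⟩

end LTree

namespace LabelledStructure

/-! ### The moment of a point -/

/-- The moment of a point of a labelled poset: its immediate subtrees are the moments of the
points above it at which more formulas of `Sig` are true. -/
noncomputable def momentTree (Sig : Finset Formula) (A : LabelledStructure.{v}) (a : A.World) :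
    LTree :=
  -- Requiring a drop in corank makes the recursion terminate even for infinite `A` and makes labels
  -- change along edges.
  LTree.ofSet ((A.label a).restrict Sig) (Set.range fun b : {b : A.World //
    a ≤ b ∧ (A.label b).corank Sig < (A.label a).corank Sig} => momentTree Sig A b.1)
termination_by (A.label a).corank Sig
decreasing_by exact b.2.2

section Moment

variable {Sig : Finset Formula} {Δ : Set Formula} {A : LabelledStructure.{v}}

theorem root_momentTree (a : A.World) :
    LTree.root (momentTree Sig A a) = (A.label a).restrict Sig := by
  rw [momentTree, LTree.root_ofSet]

theorem label_eq_or_corank_lt (hA : A.IsLabelledFrame Δ) (hs : A.IsSaturated Δ)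
    (hsub : SubClosed (Sig : Set Formula)) (hΔ : (Sig : Set Formula) ⊆ Δ) {a b : A.World}
    (h : a ≤ b) : (A.label a).restrict Sig = (A.label b).restrict Sig ∨
      (A.label b).corank Sig < (A.label a).corank Sig := by
  have := (hA.mono a b h).restrict (Γ := Sig).eq_or_corank_lt ((hA.isType a).restrict hsub)
    ((hA.isType b).restrict hsub) ((hs b).restrict hΔ)
  simpa only [TwoSided.corank_restrict] using this

theorem isMoment_momentTree (hA : A.IsLabelledFrame Δ) (hs : A.IsSaturated Δ)
    (hsub : SubClosed (Sig : Set Formula)) (hΔ : (Sig : Set Formula) ⊆ Δ) (a : A.World) :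
    LTree.IsMoment Sig (momentTree Sig A a) := by
  induction h : (A.label a).corank Sig using Nat.strong_induction_on generalizing a with
  | _ k ih =>
    subst h
    rw [momentTree]
    have hmom : ∀ t ∈ Set.range fun b : {b : A.World //
        a ≤ b ∧ (A.label b).corank Sig < (A.label a).corank Sig} => momentTree Sig A b.1,
        LTree.IsMoment Sig t := by
      rintro _ ⟨b, rfl⟩
      exact ih _ b.2.2 b.1 rfl
    -- Infinitely many points may lie above `a`, but their moments belong to a finite set.
    refine LTree.isMoment_ofSet ((LTree.finite_setOf_isMoment Sig).subset hmom)
      ((hA.isType a).restrict hsub) ((hs a).restrict hΔ) hmom ?_ ?_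
    · rintro _ ⟨b, rfl⟩
      simp only [root_momentTree]
      refine ⟨(hA.mono a b b.2.1).restrict, fun h => b.2.2.ne ?_⟩
      rw [← TwoSided.corank_restrict Sig (A.label b), ← h, TwoSided.corank_restrict]
    · rintro φ ψ ⟨hneg, hpos⟩
      have hφψ := hsub.imp_mem hneg.2
      have hpos' : φ ∉ (A.label a).pos := fun h => hpos ⟨h, hφψ.1⟩
      obtain ⟨b, hab, hφ, hψ⟩ := hA.revoke a φ ψ ⟨hneg.1, hpos'⟩
      -- The revoking point makes `φ` newly positive, so its corank drops and its moment is a child.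
      have hlt := (label_eq_or_corank_lt hA hs hsub hΔ hab).resolve_left fun h => by
        have h' : φ ∈ ((A.label a).restrict Sig).pos := h ▸ ⟨hφ, hφψ.1⟩
        exact hpos' h'.1
      refine ⟨_, ⟨⟨b, hab, hlt⟩, rfl⟩, _, .refl _, ?_⟩
      simp only [root_momentTree]
      exact ⟨⟨hφ, hφψ.1⟩, hψ, hφψ.2⟩

theorem subtree_momentTree_iff (hA : A.IsLabelledFrame Δ) (hs : A.IsSaturated Δ)
    (hsub : SubClosed (Sig : Set Formula)) (hΔ : (Sig : Set Formula) ⊆ Δ) {a : A.World}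
    {s : LTree} : LTree.Subtree (momentTree Sig A a) s ↔ s = momentTree Sig A a ∨
      ∃ b, a ≤ b ∧ (A.label b).corank Sig < (A.label a).corank Sig ∧
        LTree.Subtree (momentTree Sig A b) s := by
  rw [momentTree, LTree.subtree_ofSet_iff]
  · simp [and_assoc]
  · refine (LTree.finite_setOf_isMoment Sig).subset ?_
    rintro _ ⟨b, rfl⟩
    exact isMoment_momentTree hA hs hsub hΔ b.1

/-- This is the confluence of the relation linking the moment of a point to that point, used in
`simulates_momentTree`. -/
theorem exists_of_subtree_momentTree (hA : A.IsLabelledFrame Δ) (hs : A.IsSaturated Δ)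
    (hsub : SubClosed (Sig : Set Formula)) (hΔ : (Sig : Set Formula) ⊆ Δ) {a : A.World}
    {s : LTree} (h : LTree.Subtree (momentTree Sig A a) s) :
    ∃ b, a ≤ b ∧ s = momentTree Sig A b := by
  induction hk : (A.label a).corank Sig using Nat.strong_induction_on generalizing a with
  | _ k ih =>
    subst hk
    rcases (subtree_momentTree_iff hA hs hsub hΔ).1 h with rfl | ⟨b, hab, hlt, hb⟩
    · exact ⟨a, le_rfl, rfl⟩
    · obtain ⟨c, hbc, hc⟩ := ih _ hlt hb rfl
      exact ⟨c, hab.trans hbc, hc⟩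

theorem subtree_momentTree_of_corank_lt (hA : A.IsLabelledFrame Δ) (hs : A.IsSaturated Δ)
    (hsub : SubClosed (Sig : Set Formula)) (hΔ : (Sig : Set Formula) ⊆ Δ) {a b : A.World}
    (h : a ≤ b) (hlt : (A.label b).corank Sig < (A.label a).corank Sig) :
    LTree.Subtree (momentTree Sig A a) (momentTree Sig A b) :=
  (subtree_momentTree_iff hA hs hsub hΔ).2 (Or.inr ⟨b, h, hlt, .refl _⟩)

theorem simulates_momentTree (hA : A.IsLabelledFrame Δ) (hs : A.IsSaturated Δ)
    (hsub : SubClosed (Sig : Set Formula)) (hΔ : (Sig : Set Formula) ⊆ Δ) (a : A.World) :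
    Simulates (momentStructure Sig) A
      ⟨momentTree Sig A a, isMoment_momentTree hA hs hsub hΔ a⟩ a := by
  refine ⟨fun t b => t.1 = momentTree Sig A b, ⟨?_, ?_⟩, rfl⟩
  · rintro ⟨t, ht⟩ ⟨t', ht'⟩ b (hle : LTree.Subtree t t') rfl
    exact exists_of_subtree_momentTree hA hs hsub hΔ hle
  · rintro ⟨t, ht⟩ b rfl
    simp only [momentStructure, root_momentTree]
    exact TwoSided.restrict_sub

/-! ### Initiality of the moment structure -/

theorem momentStructure_isWeakQuasimodel (Sig : Finset Formula) :
    (momentStructure Sig).IsWeakQuasimodel (Sig : Set Formula) where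
  frame :=
    { isType := fun w => w.2.isType_root
      mono := fun w v h => w.2.root_le h
      revoke := fun w φ ψ h => by
        obtain ⟨s, hs, h'⟩ := w.2.revoke h
        exact ⟨⟨s, w.2.subtree hs⟩, hs, h'⟩ }
  continuous := by
    rintro w w' v hle ⟨R, hR, hsens, hwv⟩
    obtain ⟨v', hv, h⟩ := hR w w' v hle hwv
    exact ⟨v', hv, R, hR, hsens, h⟩
  sensible := by
    rintro w v ⟨R, -, hsens, hwv⟩
    exact hsens w v hwv

/-- If `x` simulates `y`, the moment of the successor `y'` serves as successor of `x`: the relation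
is obtained by composing `⇀`, the successor relation of `A` and the passage to moments. -/
theorem isDynamic_simulates_momentStructure (hA : A.IsWeakQuasimodel Δ) (hs : A.IsSaturated Δ)
    (hsub : SubClosed (Sig : Set Formula))
    (hΔ : (Sig : Set Formula) ⊆ Δ) :
    IsDynamic (momentStructure Sig) A (Simulates (momentStructure Sig) A) := by
  intro x y y' hxy hyy'
  have hF := hA.frame
  have hsim := isSimulation_simulates (momentStructure Sig) A
  refine ⟨⟨_, isMoment_momentTree hF hs hsub hΔ y'⟩, ?_, simulates_momentTree hF hs hsub hΔ y'⟩
  -- The extra point `c` is needed for confluence: moving up from `b'` to `d'` without changing the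
  -- label on `Sig` need not yield a subtree, so the moment of `c` is kept. Once the corank drops,
  -- the moment of `d'` is a proper subtree and `c` is reset to `d'`.
  refine ⟨fun z t => ∃ b b' c, Simulates (momentStructure Sig) A z b ∧ A.succ b b' ∧ c ≤ b' ∧
    (A.label c).restrict Sig = (A.label b').restrict Sig ∧ t.1 = momentTree Sig A c, ?_, ?_,
    y, y', y', hxy, hyy', le_rfl, rfl, rfl⟩
  · rintro z z' ⟨t, ht⟩ hz ⟨b, b', c, hzb, hbb', hc, hlab, rfl⟩
    obtain ⟨d, hbd, hz'd⟩ := hsim.continuous z z' b hz hzb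
    obtain ⟨d', hbd', hdd'⟩ := hA.continuous b d b' hbd hbb'
    rcases label_eq_or_corank_lt hF hs hsub hΔ (hc.trans hbd') with heq | hlt
    · exact ⟨⟨_, ht⟩, le_rfl, d, d', c, hz'd, hdd', hc.trans hbd', heq, rfl⟩
    · exact ⟨⟨_, isMoment_momentTree hF hs hsub hΔ d'⟩,
        subtree_momentTree_of_corank_lt hF hs hsub hΔ (hc.trans hbd') hlt,
        d, d', d', hz'd, hdd', le_rfl, rfl, rfl⟩
  · rintro z ⟨t, ht⟩ ⟨b, b', c, hzb, hbb', hc, hlab, rfl⟩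
    -- Saturation turns the label inclusion of a simulation into equality on `Sig`, so sensibility
    -- transfers from `A`.
    have hz : LTree.root z.1 = (A.label b).restrict Sig :=
      (hsim.label z b hzb).eq_restrict z.2.isType_root z.2.saturated_root (hF.isType b)
    rw [hz, root_momentTree, hlab]
    exact (hA.sensible b b' hbb').restrict hsub

theorem momentStructure_isInitial (hsub : SubClosed (Sig : Set Formula)) :
    IsInitial.{0, v} Sig (momentStructure Sig) where
  weak := momentStructure_isWeakQuasimodel Sig
  saturated w := w.2.saturated_root
  universal _ A hΔ _ hA hs _ := ⟨isSimulation_simulates _ A,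
    isDynamic_simulates_momentStructure hA hs hsub hΔ,
    fun a => ⟨_, simulates_momentTree hA.frame hs hsub hΔ a⟩⟩

end Moment

end LabelledStructure

end ITL

/-- For every admissible logic `Λ` over a language `L_M` and every finite subformula-closed
`Sig ⊆ L_M`: the structure of moments is an initial weak quasimodel over `Sig`, and for it (as for
every other initial weak quasimodel over `Sig`) the structure of possible worlds is a weak
quasimodel whose successor relation is serial and `ω`-sensible, and a quasimodel if no formula
`∀ φ` belongs to `Sig`. -/
theorem mainTheorem11 (M : Set ITL.Modality) (Λ : Set ITL.Formula) (hΛ : ITL.IsAdmissible M Λ)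
    (Sig : Finset ITL.Formula) (hSig : (Sig : Set ITL.Formula) ⊆ ITL.Lang M)
    (hsub : ITL.SubClosed (Sig : Set ITL.Formula)) :
    (Finite (ITL.momentStructure Sig).World ∧
      ITL.LabelledStructure.IsInitial.{0, v} Sig (ITL.momentStructure Sig)) ∧
    ∀ (I : ITL.LabelledStructure.{u}) [Finite I.World],
      ITL.LabelledStructure.IsInitial.{u, 0} Sig I →
      (I.initialStructure Λ Sig).IsWeakQuasimodel (Sig : Set ITL.Formula) ∧
      (I.initialStructure Λ Sig).Serial ∧
      (I.initialStructure Λ Sig).OmegaSensible ∧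
      ((∀ φ, ITL.Formula.all φ ∉ Sig) →
        (I.initialStructure Λ Sig).IsQuasimodel (Sig : Set ITL.Formula)) := by
  refine ⟨⟨(ITL.LTree.finite_setOf_isMoment Sig).to_subtype,
    ITL.LabelledStructure.momentStructure_isInitial hsub⟩, fun I _ hI => ?_⟩
  have hw := hI.initialStructure_isWeakQuasimodel hΛ hSig
  have hω := hI.initialStructure_omegaSensible hΛ hSig hsub
  exact ⟨hw, hω.1, hω, fun h =>
    ⟨hw, ITL.LabelledStructure.honest_of_all_notMem hw.frame h, hω⟩⟩
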